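/- For a point $c\in\mathbb{R}^n$, the $n$-dimensional cross centered at $c$ is the union of the $2n+1$ closed axis-parallel unit cubes centered at $c$ and at $c\pm e_i$ ($1\le i\le n$), where $e_1,\dots,e_n$ is the standard basis; that is, the central unit cube together with its reflections in all its faces. A tiling of $\mathbb{R}^n$ by crosses is a set of crosses whose union is $\mathbb{R}^n$ and in which distinct crosses have disjoint interiors. It is a $\mathbb{Z}$-tiling if the centers of all its crosses lie in $\mathbb{Z}^n$. Two tilings $\mathcal{T}$ and $\mathcal{S}$ are congruent if there is a (not necessarily origin-fixing) Euclidean isometry of $\mathbb{R}^n$ onto itself that maps the crosses of $\mathcal{T}$ onto the crosses of $\mathcal{S}$. A tiling by crosses is called regular if it is congruent to a $\mathbb{Z}$-tiling by crosses, and non-regular otherwise. **Theorem.** Let $n$ be a natural number such that $2n+1$ is prime. If there is, up to congruence, a unique $\mathbb{Z}$-tiling of $\mathbb{R}^n$ by crosses, then there is no non-regular tiling of $\mathbb{R}^n$ by crosses. -/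

import Mathlib

namespace CrossTiling

/-- Euclidean `n`-space `ℝⁿ`. -/
abbrev Space (n : ℕ) : Type := EuclideanSpace ℝ (Fin n)

/-- The closed axis-parallel unit cube of `ℝⁿ` with centre `c`. -/
def unitCube {n : ℕ} (c : Space n) : Set (Space n) :=
  {x | ∀ i, |x i - c i| ≤ 1 / 2}

/-- The `n`-dimensional cross with centre `c`: the unit cube centred at `c`, together with its
reflections in all of its `2n` faces, which are the unit cubes centred at `c + eᵢ` and `c - eᵢ`. -/
def cross {n : ℕ} (c : Space n) : Set (Space n) :=
  unitCube c ∪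
    ⋃ i : Fin n, (unitCube (c + EuclideanSpace.single i 1) ∪
      unitCube (c - EuclideanSpace.single i 1))

/-- A tiling of `ℝⁿ` by crosses: a family of crosses that covers `ℝⁿ` and in which two distinct
members have disjoint interiors. -/
structure IsTiling {n : ℕ} (L : Set (Set (Space n))) : Prop where
  isCross : ∀ K ∈ L, ∃ c : Space n, K = cross c
  covers : ⋃₀ L = Set.univ
  disjoint : ∀ K ∈ L, ∀ K' ∈ L, K ≠ K' → Disjoint (interior K) (interior K')

/-- A `ℤ`-tiling of `ℝⁿ` by crosses: the centres of all crosses have integer coordinates. -/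
structure IsZTiling {n : ℕ} (L : Set (Set (Space n))) : Prop where
  isTiling : IsTiling L
  integral : ∀ c : Space n, cross c ∈ L → ∀ i, ∃ m : ℤ, c i = m

/-- Two tilings are congruent if a distance preserving affine bijection of `ℝⁿ` maps (the crosses
of) the first one onto (the crosses of) the second one. -/
def Congruent {n : ℕ} (L M : Set (Set (Space n))) : Prop :=
  ∃ g : Space n ≃ᵃⁱ[ℝ] Space n, (fun K : Set (Space n) => g '' K) '' L = M

/-- A tiling is regular if it is congruent to a `ℤ`-tiling by crosses. -/
def IsRegular {n : ℕ} (L : Set (Set (Space n))) : Prop :=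
  ∃ M : Set (Set (Space n)), IsZTiling M ∧ Congruent L M

/-- Up to congruence, there is exactly one `ℤ`-tiling of `ℝⁿ` by crosses. -/
def UniqueZTiling (n : ℕ) : Prop :=
  ∃ D : Set (Set (Space n)), IsZTiling D ∧
    ∀ L : Set (Set (Space n)), IsZTiling L → Congruent L D

end CrossTiling

namespace CrossTiling

open Filter Topology

/-! ### Half-open tilings -/

/-! Along a line parallel to the i-th axis, half-open crosses cut out unit intervals, so the i-th
coordinates of the centres met agree modulo 1. Residue classes of one coordinate can therefore be
moved independently (`IsHalfOpenTiling.image_pi`).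

If centres a, b have b_i - a_i not an integer, rounding all coordinates down gives an integer tiling
Λ; also adding 1 to the i-th coordinate outside the class of a_i gives Λ', which is Λ with some but
not all elements moved by e_i. By uniqueness both are congruent to the standard lattice tiling,
hence closed under x - y + z (`UniqueZTiling.sub_add_mem`), and `false_of_partial_shift` refutes
this. So all centres agree modulo 1, and a translation makes them integral (`IsTiling.isRegular`).
-/

/-- The integer vectors `0`, `eᵢ` and `-eᵢ`. -/
def IsStep {n : ℕ} (q : Fin n → ℤ) : Prop :=
  q = 0 ∨ ∃ i, q = Pi.single i 1 ∨ q = -Pi.single i 1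

lemma IsStep.neg {n : ℕ} {q : Fin n → ℤ} (hq : IsStep q) : IsStep (-q) := by
  rcases hq with rfl | ⟨i, rfl | rfl⟩
  · exact Or.inl neg_zero
  · exact Or.inr ⟨i, Or.inr rfl⟩
  · exact Or.inr ⟨i, Or.inl (neg_neg _)⟩

lemma finite_isStep (n : ℕ) : {q : Fin n → ℤ | IsStep q}.Finite := by
  have h : {q : Fin n → ℤ | IsStep q} ⊆
      {0} ∪ (Set.range (fun i => Pi.single i 1) ∪ Set.range (fun i => -Pi.single i 1)) := by
    rintro q (rfl | ⟨i, rfl | rfl⟩)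
    · exact Or.inl rfl
    · exact Or.inr (Or.inl ⟨i, rfl⟩)
    · exact Or.inr (Or.inr ⟨i, rfl⟩)
  exact ((Set.finite_singleton _).union ((Set.finite_range _).union (Set.finite_range _))).subset h

/-- The half-open crosses `{y | ⌊y - c⌋ is a step}`, `c ∈ C`, partition `ℝⁿ`. -/
def IsHalfOpenTiling {n : ℕ} (C : Set (Fin n → ℝ)) : Prop :=
  ∀ y : Fin n → ℝ, ∃! c, c ∈ C ∧ IsStep fun j => ⌊y j - c j⌋

/-- The integer translates of the set of steps by the elements of `Λ` partition `ℤⁿ`. -/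
def IsIntTiling {n : ℕ} (Λ : Set (Fin n → ℤ)) : Prop :=
  ∀ z : Fin n → ℤ, ∃! l, l ∈ Λ ∧ IsStep (z - l)

/-- The coordinatewise inclusion of `ℤⁿ` in `ℝⁿ`. -/
def realVec {n : ℕ} (z : Fin n → ℤ) : Fin n → ℝ := fun j => z j

lemma realVec_injective {n : ℕ} : Function.Injective (realVec (n := n)) := fun a b h =>
  funext fun j => by simpa [realVec] using congrFun h j

lemma isHalfOpenTiling_realVec {n : ℕ} {Λ : Set (Fin n → ℤ)} :
    IsHalfOpenTiling (realVec '' Λ) ↔ IsIntTiling Λ := by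
  constructor
  · intro h z
    obtain ⟨_, ⟨⟨l, hl, rfl⟩, hs⟩, hu⟩ := h (realVec z)
    have key : ∀ l : Fin n → ℤ, (fun j => ⌊realVec z j - realVec l j⌋) = z - l := by
      intro l
      funext j
      simp only [realVec, Pi.sub_apply]
      exact_mod_cast Int.floor_intCast (R := ℝ) (z j - l j)
    rw [key] at hs
    refine ⟨l, ⟨hl, hs⟩, fun l' hl' => realVec_injective (hu _ ⟨⟨l', hl'.1, rfl⟩, ?_⟩)⟩
    rw [key]
    exact hl'.2
  · intro h y
    obtain ⟨l, ⟨hl, hs⟩, hu⟩ := h fun j => ⌊y j⌋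
    have key : ∀ l : Fin n → ℤ, (fun j => ⌊y j - realVec l j⌋) = (fun j => ⌊y j⌋) - l := by
      intro l
      funext j
      simp [realVec]
    refine ⟨realVec l, ⟨⟨l, hl, rfl⟩, by rwa [key]⟩, ?_⟩
    rintro _ ⟨⟨l', hl', rfl⟩, hs'⟩
    rw [hu l' ⟨hl', by rwa [key] at hs'⟩]

/-! ### Shifting residue classes -/

/-- A partition of the line into half-open unit intervals is a translate of the standard one. -/
lemma exists_int_of_unit_intervals (g : ℝ → ℝ) (h₁ : ∀ t, g t ≤ t ∧ t < g t + 1)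
    (h₂ : ∀ s t, g t ≤ s → s < g t + 1 → g s = g t) (s t : ℝ) : ∃ m : ℤ, g s = g t + m := by
  -- Were the interval of a + 1 to start earlier, it would meet [a, a + 1) at the larger left end,
  -- so the two would coincide.
  have step : ∀ a, g a = a → g (a + 1) = a + 1 := by
    intro a ha
    by_contra hne
    have hb := h₁ (a + 1)
    have hlt : g (a + 1) < a + 1 := lt_of_le_of_ne hb.1 hne
    have e₁ := h₂ (max a (g (a + 1))) a (by rw [ha]; exact le_max_left _ _)
      (by rw [ha]; exact max_lt (by linarith) hlt)
    have e₂ := h₂ (max a (g (a + 1))) (a + 1) (le_max_right _ _)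
      (max_lt (by linarith) (by linarith))
    linarith
  have fix : ∀ t, g (g t) = g t := fun t => h₂ _ _ le_rfl (by linarith)
  have steps : ∀ t, ∀ k : ℕ, g (g t + k) = g t + k := by
    intro t k
    induction k with
    | zero => simpa using fix t
    | succ k ih =>
      have := step _ ih
      push_cast
      rwa [← add_assoc]
  have mono : ∀ s t, t ≤ s → ∃ m : ℤ, g s = g t + m := by
    intro s t hts
    have h0 : 0 ≤ s - g t := by linarith [(h₁ t).1]
    have hk := steps t ⌊s - g t⌋₊
    refine ⟨(⌊s - g t⌋₊ : ℤ), ?_⟩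
    have := h₂ s (g t + ⌊s - g t⌋₊) (by rw [hk]; linarith [Nat.floor_le h0])
      (by rw [hk]; linarith [Nat.lt_floor_add_one (s - g t)])
    rw [this, hk]
    norm_cast
  rcases le_total t s with h | h
  · exact mono s t h
  · obtain ⟨m, hm⟩ := mono t s h
    exact ⟨-m, by push_cast; linarith⟩

/-- The crosses of a half-open tiling that meet a line parallel to the `i`-th axis have
`i`-th coordinates that agree modulo `1`. -/
lemma IsHalfOpenTiling.exists_int {n : ℕ} {C : Set (Fin n → ℝ)} (hC : IsHalfOpenTiling C)
    (i : Fin n) (y : Fin n → ℝ) (t : ℝ) {c c' : Fin n → ℝ} (hc : c ∈ C) (hc' : c' ∈ C)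
    (hs : IsStep fun j => ⌊y j - c j⌋)
    (hs' : IsStep fun j => ⌊Function.update y i t j - c' j⌋) :
    ∃ m : ℤ, c' i = c i + m := by
  choose f hf hu using hC
  set d : ℝ → Fin n → ℝ := fun t => f (Function.update y i t) with hd
  -- The left end of the unit interval cut from the line by the cube containing its point with i-th
  -- coordinate t.
  have := exists_int_of_unit_intervals (fun t => d t i + ⌊t - d t i⌋)
    (fun t => ⟨by linarith [Int.floor_le (t - d t i)],
      by linarith [Int.lt_floor_add_one (t - d t i)]⟩)
    (by
      intro s t h1 h2
      have hfl : ⌊s - d t i⌋ = ⌊t - d t i⌋ := by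
        rw [Int.floor_eq_iff]
        constructor <;> linarith
      have hst : d t = d s := by
        refine hu (Function.update y i s) (d t) ⟨(hf _).1, ?_⟩
        convert (hf (Function.update y i t)).2 using 2 with j
        by_cases hj : j = i
        · subst hj
          simpa using hfl
        · simp [hj, hd]
      rw [← hst, hfl]) t (y i)
  have e : c = d (y i) := hu _ _ ⟨hc, by simpa using hs⟩
  have e' : c' = d t := hu _ _ ⟨hc', hs'⟩
  obtain ⟨m, hm⟩ := this
  rw [e, e']
  refine ⟨m + ⌊y i - d (y i) i⌋ - ⌊t - d t i⌋, ?_⟩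
  push_cast
  linarith

/-- On each line parallel to the i-th axis only one residue class occurs, and `ψ` moves it by a
single amount; the partition of the line is merely translated. Neither injectivity nor continuity of
`ψ` is needed. -/
lemma IsHalfOpenTiling.image_update {n : ℕ} {C : Set (Fin n → ℝ)} (hC : IsHalfOpenTiling C)
    (i : Fin n) (ψ : ℝ → ℝ) (hψ : ∀ (t : ℝ) (m : ℤ), ψ (t + m) = ψ t + m) :
    IsHalfOpenTiling ((fun c => Function.update c i (ψ (c i))) '' C) := by
  intro y
  have key : ∀ c : Fin n → ℝ, (fun j => ⌊y j - Function.update c i (ψ (c i)) j⌋) =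
      fun j => ⌊Function.update y i (y i - (ψ (c i) - c i)) j - c j⌋ := by
    intro c
    funext j
    by_cases hj : j = i
    · subst hj
      simp only [Function.update_self]
      congr 1
      ring
    · simp [hj]
  obtain ⟨c₀, ⟨h₀, hs₀⟩, -⟩ := hC y
  obtain ⟨c₁, ⟨h₁, hs₁⟩, hu₁⟩ := hC (Function.update y i (y i - (ψ (c₀ i) - c₀ i)))
  have shift : ∀ c ∈ C, ∀ t, (IsStep fun j => ⌊Function.update y i t j - c j⌋) →
      ψ (c i) - c i = ψ (c₀ i) - c₀ i := by
    intro c hc t hs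
    obtain ⟨m, hm⟩ := hC.exists_int i y t h₀ hc hs₀ hs
    rw [hm, hψ]
    ring
  refine ⟨_, ⟨⟨c₁, h₁, rfl⟩, ?_⟩, ?_⟩
  · simp only [key]
    rw [shift c₁ h₁ _ hs₁]
    exact hs₁
  · rintro _ ⟨⟨c₂, h₂, rfl⟩, hs₂⟩
    simp only [key] at hs₂
    rw [shift c₂ h₂ _ hs₂] at hs₂
    rw [hu₁ c₂ ⟨h₂, hs₂⟩]

lemma IsHalfOpenTiling.image_pi {n : ℕ} {C : Set (Fin n → ℝ)} (hC : IsHalfOpenTiling C)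
    (ψ : Fin n → ℝ → ℝ) (hψ : ∀ i (t : ℝ) (m : ℤ), ψ i (t + m) = ψ i t + m) :
    IsHalfOpenTiling ((fun c j => ψ j (c j)) '' C) := by
  have key : ∀ s : Finset (Fin n),
      IsHalfOpenTiling ((fun c j => if j ∈ s then ψ j (c j) else c j) '' C) := by
    intro s
    induction s using Finset.induction_on with
    | empty => simpa using hC
    | insert i s hi ih =>
      have := ih.image_update i (ψ i) (hψ i)
      rw [Set.image_image] at this
      convert this using 3 with c _ j
      by_cases hj : j = i
      · subst hj
        simp [hi]
      · simp [hj]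
  simpa using key Finset.univ

lemma IsHalfOpenTiling.translate {n : ℕ} {C : Set (Fin n → ℝ)} (hC : IsHalfOpenTiling C)
    (v : Fin n → ℝ) : IsHalfOpenTiling ((fun c => c - v) '' C) := by
  refine hC.image_pi (fun j t => t - v j) fun j t m => ?_
  ring

/-! ### Crosses -/

lemma mem_cross {n : ℕ} {c x : Space n} :
    x ∈ cross c ↔ ∃ q : Fin n → ℤ, IsStep q ∧ ∀ j, |x j - (c j + q j)| ≤ 1 / 2 := by
  have hs : ∀ i j : Fin n, ((Pi.single i (1 : ℤ) : Fin n → ℤ) j : ℝ) =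
      (EuclideanSpace.single i (1 : ℝ) : Space n) j := by
    intro i j
    by_cases h : j = i
    · subst h
      simp
    · simp [h]
  constructor
  · intro h
    rcases h with h | h
    · exact ⟨0, Or.inl rfl, by simpa [unitCube] using h⟩
    · obtain ⟨i, h | h⟩ := Set.mem_iUnion.1 h
      · exact ⟨Pi.single i 1, Or.inr ⟨i, Or.inl rfl⟩, fun j => by rw [hs]; exact h j⟩
      · refine ⟨-Pi.single i 1, Or.inr ⟨i, Or.inr rfl⟩, fun j => ?_⟩
        rw [Pi.neg_apply, Int.cast_neg, hs]
        exact h j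
  · rintro ⟨q, rfl | ⟨i, rfl | rfl⟩, h⟩
    · exact Or.inl (by simpa [unitCube] using h)
    · refine Or.inr (Set.mem_iUnion.2 ⟨i, Or.inl fun j => ?_⟩)
      have := h j
      rw [hs] at this
      exact this
    · refine Or.inr (Set.mem_iUnion.2 ⟨i, Or.inr fun j => ?_⟩)
      have := h j
      rw [Pi.neg_apply, Int.cast_neg, hs] at this
      exact this

lemma self_mem_cross {n : ℕ} (c : Space n) : c ∈ cross c :=
  mem_cross.2 ⟨0, Or.inl rfl, by simp⟩

lemma reflect_mem_cross {n : ℕ} {c x : Space n} (hx : x ∈ cross c) : c + c - x ∈ cross c := by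
  obtain ⟨q, hq, h⟩ := mem_cross.1 hx
  refine mem_cross.2 ⟨-q, hq.neg, fun j => ?_⟩
  rw [← abs_neg]
  convert h j using 2
  simp
  ring

lemma IsStep.abs_le {n : ℕ} {q : Fin n → ℤ} (hq : IsStep q) (j : Fin n) : |(q j : ℝ)| ≤ 1 := by
  rcases hq with rfl | ⟨i, rfl | rfl⟩
  · simp
  all_goals
    by_cases h : j = i
    · subst h
      simp
    · simp [h]

lemma abs_sub_le_of_mem_cross {n : ℕ} {c x : Space n} (hx : x ∈ cross c) (j : Fin n) :
    |x j - c j| ≤ 3 / 2 := by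
  obtain ⟨q, hq, h⟩ := mem_cross.1 hx
  have h1 := abs_le.1 (h j)
  have h2 := abs_le.1 (hq.abs_le j)
  rw [_root_.abs_le]
  constructor <;> linarith

/-- An affine isometry that maps a cross onto a cross maps the centre to the centre. -/
lemma map_center {n : ℕ} (g : Space n ≃ᵃⁱ[ℝ] Space n) {c d : Space n}
    (h : (fun x => g x) '' cross c = cross d) : g c = d := by
  have refl' : ∀ x ∈ cross d, g c + g c - x ∈ cross d := by
    intro x hx
    rw [← h] at hx
    obtain ⟨y, hy, rfl⟩ := hx
    rw [← h]
    refine ⟨_, reflect_mem_cross hy, ?_⟩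
    have e : c + c - y = (c -ᵥ y) +ᵥ c := by simp only [vsub_eq_sub, vadd_eq_add]; abel
    dsimp only
    rw [e, AffineIsometryEquiv.map_vadd, AffineIsometryEquiv.map_vsub]
    simp only [vsub_eq_sub, vadd_eq_add]
    abel
  -- Both `d` and `g c` are centres of symmetry; composing the two reflections gives a translation
  -- by 2(g c - d), whose iterates would leave the bounded cross.
  have iter : ∀ k : ℕ, d + k • ((g c - d) + (g c - d)) ∈ cross d := by
    intro k
    induction k with
    | zero => simpa using self_mem_cross d
    | succ k ih =>
      have := refl' _ (reflect_mem_cross ih)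
      convert this using 1
      rw [succ_nsmul]
      abel
  ext j
  by_contra hne
  have hpos : 0 < |g c j - d j| := abs_pos.2 (sub_ne_zero.2 hne)
  obtain ⟨k, hk⟩ := exists_nat_gt (2 / |g c j - d j|)
  rw [div_lt_iff₀ hpos] at hk
  have hb := abs_sub_le_of_mem_cross (iter k) j
  have e : (d + k • ((g c - d) + (g c - d))) j - d j = 2 * (k * (g c j - d j)) := by
    simp
    ring
  rw [e, abs_mul, abs_mul, Nat.abs_cast, abs_two] at hb
  linarith

lemma cross_injective {n : ℕ} : Function.Injective (cross (n := n)) := fun c d h => by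
  simpa using map_center (AffineIsometryEquiv.refl ℝ (Space n)) (c := c) (d := d) (by simpa using h)

/-! ### Closed and half-open tilings -/

/-- The point with all coordinates of `y` moved by `ε - 1/2`. -/
noncomputable def nudge {n : ℕ} (y : Fin n → ℝ) (ε : ℝ) : Space n := WithLp.toLp 2 fun j => y j - 1 / 2 + ε

lemma tendsto_nudge {n : ℕ} (y : Fin n → ℝ) :
    Tendsto (nudge y) (𝓝[>] 0) (𝓝 (nudge y 0)) := by
  have : Continuous (nudge y) := by
    unfold nudge
    fun_prop
  exact (this.tendsto 0).mono_left nhdsWithin_le_nhds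

/-- If finitely many closed cubes contain the points `nudge y ε` for all small `ε > 0`, one of the
half-open cubes contains `y`. -/
lemma exists_floor_eq {n : ℕ} (y : Fin n → ℝ) {F : Set ((Fin n → ℝ) × (Fin n → ℤ))}
    (hF : F.Finite)
    (h : ∀ᶠ ε in 𝓝[>] (0 : ℝ), ∃ p ∈ F, ∀ j, |nudge y ε j - (p.1 j + p.2 j)| ≤ 1 / 2) :
    ∃ p ∈ F, ∀ j, ⌊y j - p.1 j⌋ = p.2 j := by
  by_contra! hne
  have : ∀ p ∈ F, ∀ᶠ ε in 𝓝[>] (0 : ℝ), ¬ ∀ j, |nudge y ε j - (p.1 j + p.2 j)| ≤ 1 / 2 := by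
    intro p hp
    obtain ⟨j, hj⟩ := hne p hp
    have hj' : y j < p.1 j + p.2 j ∨ p.1 j + p.2 j + 1 ≤ y j := by
      by_contra! hh
      exact hj (Int.floor_eq_iff.2 ⟨by linarith, by linarith⟩)
    rcases hj' with hj' | hj'
    · have hlt : (0 : ℝ) < p.1 j + p.2 j - y j := by linarith
      filter_upwards [Ioo_mem_nhdsGT hlt] with ε hε hall
      have := (abs_le.1 (hall j)).1
      simp only [nudge] at this
      linarith [hε.2]
    · filter_upwards [self_mem_nhdsWithin] with ε hε hall
      have := (abs_le.1 (hall j)).2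
      simp only [nudge] at this
      have hε' : 0 < ε := hε
      linarith
  have hall := (Filter.eventually_all_finite hF).2 this
  obtain ⟨ε, ⟨p, hp, h1⟩, h2⟩ := (h.and hall).exists
  exact h2 p hp h1

lemma mem_interior_cross {n : ℕ} {c x : Space n} {q : Fin n → ℤ} (hq : IsStep q)
    (h : ∀ j, |x j - (c j + q j)| < 1 / 2) : x ∈ interior (cross c) := by
  refine mem_interior.2 ⟨{x | ∀ j, |x j - (c j + q j)| < 1 / 2},
    fun x hx => mem_cross.2 ⟨q, hq, fun j => (hx j).le⟩, ?_, h⟩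
  rw [Set.ofPred_forall]
  exact isOpen_iInter_of_finite fun j => isOpen_lt (by fun_prop) continuous_const

/-- Half-open cubes contain their lower faces, so a small positive push in all coordinates leads
into the open cube. -/
lemma eventually_mem_interior_cross {n : ℕ} {c y : Fin n → ℝ}
    (h : IsStep fun j => ⌊y j - c j⌋) :
    ∀ᶠ ε in 𝓝[>] (0 : ℝ), nudge y ε ∈ interior (cross (WithLp.toLp 2 c)) := by
  have : ∀ j, ∀ᶠ ε in 𝓝[>] (0 : ℝ), |nudge y ε j - (c j + ⌊y j - c j⌋)| < 1 / 2 := by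
    intro j
    have h1 := Int.floor_le (y j - c j)
    have h2 := Int.lt_floor_add_one (y j - c j)
    have hlt : (0 : ℝ) < c j + ⌊y j - c j⌋ + 1 - y j := by linarith
    filter_upwards [Ioo_mem_nhdsGT hlt] with ε hε
    rw [abs_lt]
    simp only [nudge]
    constructor <;> linarith [hε.1, hε.2]
  filter_upwards [Filter.eventually_all.2 this] with ε hε
  exact mem_interior_cross h hε

lemma isStep_floor_of_mem_interior {n : ℕ} {c : Fin n → ℝ} {y : Fin n → ℝ}
    (h : nudge y 0 ∈ interior (cross (WithLp.toLp 2 c))) : IsStep fun j => ⌊y j - c j⌋ := by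
  have hev : ∀ᶠ ε in 𝓝[>] (0 : ℝ), nudge y ε ∈ cross (WithLp.toLp 2 c) :=
    (tendsto_nudge y).eventually (mem_interior_iff_mem_nhds.1 h)
  obtain ⟨⟨c', q⟩, ⟨rfl, hq⟩, hfl⟩ := exists_floor_eq y
    ((Set.finite_singleton c).prod (finite_isStep n)) (by
      filter_upwards [hev] with ε hε
      obtain ⟨q, hq, hj⟩ := mem_cross.1 hε
      exact ⟨(c, q), ⟨rfl, hq⟩, hj⟩)
  rw [show (fun j => ⌊y j - c' j⌋) = q from funext hfl]
  exact hq

/-- The set of crosses with centres in `C`. -/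
def crosses {n : ℕ} (C : Set (Fin n → ℝ)) : Set (Set (Space n)) :=
  (fun c => cross (WithLp.toLp 2 c)) '' C

/-- The set of centres of the crosses in `L`. -/
def centers {n : ℕ} (L : Set (Set (Space n))) : Set (Fin n → ℝ) :=
  {c | cross (WithLp.toLp 2 c) ∈ L}

lemma crosses_centers {n : ℕ} {L : Set (Set (Space n))} (hL : IsTiling L) :
    crosses (centers L) = L := by
  ext K
  constructor
  · rintro ⟨c, hc, rfl⟩
    exact hc
  · intro hK
    obtain ⟨c, rfl⟩ := hL.isCross K hK
    exact ⟨c.ofLp, hK, rfl⟩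

lemma IsHalfOpenTiling.isTiling {n : ℕ} {C : Set (Fin n → ℝ)} (hC : IsHalfOpenTiling C) :
    IsTiling (crosses C) := by
  refine ⟨?_, ?_, ?_⟩
  · rintro _ ⟨c, -, rfl⟩
    exact ⟨_, rfl⟩
  · refine Set.eq_univ_of_forall fun x => ?_
    obtain ⟨c, ⟨hc, hs⟩, -⟩ := hC fun j => x j + 1 / 2
    refine ⟨_, ⟨c, hc, rfl⟩, mem_cross.2 ⟨_, hs, fun j => ?_⟩⟩
    have h1 := Int.floor_le (x j + 1 / 2 - c j)
    have h2 := Int.lt_floor_add_one (x j + 1 / 2 - c j)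
    rw [abs_le]
    constructor <;> dsimp only <;> linarith
  · rintro _ ⟨c, hc, rfl⟩ _ ⟨c', hc', rfl⟩ hne
    rw [Set.disjoint_left]
    intro x hx hx'
    have e : x = nudge (fun j => x j + 1 / 2) 0 := by
      ext j
      simp [nudge]
    rw [e] at hx hx'
    refine hne ?_
    rw [(hC _).unique ⟨hc, isStep_floor_of_mem_interior hx⟩
      ⟨hc', isStep_floor_of_mem_interior hx'⟩]

lemma IsTiling.eq_of_mem_interior {n : ℕ} {L : Set (Set (Space n))} (hL : IsTiling L)
    {c c' : Fin n → ℝ} (hc : c ∈ centers L) (hc' : c' ∈ centers L) {x : Space n}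
    (hx : x ∈ interior (cross (WithLp.toLp 2 c)))
    (hx' : x ∈ interior (cross (WithLp.toLp 2 c'))) : c = c' := by
  by_contra hne
  exact Set.disjoint_left.1 (hL.disjoint _ hc _ hc'
    fun h => hne (WithLp.toLp_injective 2 (cross_injective h))) hx hx'

/-- Two centres with equal floors have overlapping central cubes, witnessed by their midpoint, so
floors separate centres. The bound 3 is generous. -/
lemma IsTiling.finite_centers_near {n : ℕ} {L : Set (Set (Space n))} (hL : IsTiling L)
    (y : Fin n → ℝ) : {c ∈ centers L | ∀ j, |y j - c j| ≤ 3}.Finite := by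
  refine Set.Finite.of_injOn (f := fun (c : Fin n → ℝ) j => ⌊c j⌋)
    (t := Set.Icc (fun j => ⌊y j - 3⌋) (fun j => ⌊y j + 3⌋)) ?_ ?_ (Set.finite_Icc _ _)
  · rintro c ⟨-, hc⟩
    constructor <;> intro j <;> have := abs_le.1 (hc j) <;> refine Int.floor_mono ?_ <;> linarith
  · rintro c ⟨hc, -⟩ c' ⟨hc', -⟩ h
    have hlt : ∀ j, |c j - c' j| < 1 := fun j => Int.abs_sub_lt_one_of_floor_eq_floor (congrFun h j)
    refine hL.eq_of_mem_interior hc hc' (x := WithLp.toLp 2 fun j => (c j + c' j) / 2)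
      (mem_interior_cross (q := 0) (Or.inl rfl) fun j => ?_)
      (mem_interior_cross (q := 0) (Or.inl rfl) fun j => ?_)
    all_goals
      have := abs_lt.1 (hlt j)
      rw [abs_lt]
      simp
      constructor <;> linarith

lemma IsTiling.isHalfOpenTiling {n : ℕ} {L : Set (Set (Space n))} (hL : IsTiling L) :
    IsHalfOpenTiling (centers L) := by
  intro y
  obtain ⟨⟨c, q⟩, ⟨⟨hc, -⟩, hq⟩, hfl⟩ := exists_floor_eq y
    ((hL.finite_centers_near y).prod (finite_isStep n)) (by
      -- Each pushed point lies in some closed cross with centre near `y`; finitely many candidates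
      -- remain, so `exists_floor_eq` applies.
      filter_upwards [Ioo_mem_nhdsGT (zero_lt_one' ℝ)] with ε hε
      obtain ⟨K, hK, hmem⟩ : nudge y ε ∈ ⋃₀ L := hL.covers ▸ Set.mem_univ _
      obtain ⟨c, rfl⟩ := hL.isCross K hK
      obtain ⟨q, hq, h⟩ := mem_cross.1 hmem
      refine ⟨(c.ofLp, q), ⟨⟨hK, fun j => ?_⟩, hq⟩, h⟩
      have := abs_le.1 (abs_sub_le_of_mem_cross hmem j)
      simp only [nudge] at this
      rw [abs_le]
      constructor <;> linarith [hε.1, hε.2])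
  have hs : IsStep fun j => ⌊y j - c j⌋ := by
    rw [show (fun j => ⌊y j - c j⌋) = q from funext hfl]
    exact hq
  refine ⟨c, ⟨hc, hs⟩, ?_⟩
  rintro c' ⟨hc', hs'⟩
  obtain ⟨ε, h1, h2⟩ :=
    ((eventually_mem_interior_cross hs').and (eventually_mem_interior_cross hs)).exists
  exact hL.eq_of_mem_interior hc' hc h1 h2

/-! ### Integer tilings -/

lemma IsIntTiling.isZTiling {n : ℕ} {Λ : Set (Fin n → ℤ)} (h : IsIntTiling Λ) :
    IsZTiling (crosses (realVec '' Λ)) := by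
  refine ⟨(isHalfOpenTiling_realVec.2 h).isTiling, ?_⟩
  rintro c ⟨_, ⟨l, -, rfl⟩, hc⟩ i
  rw [← cross_injective hc]
  exact ⟨l i, rfl⟩

/-- The weight `∑ (j + 1) z_j`. -/
def weight {n : ℕ} (z : Fin n → ℤ) : ℤ := ∑ j : Fin n, ((j : ℕ) + 1 : ℤ) * z j

lemma weight_sub {n : ℕ} (a b : Fin n → ℤ) : weight (a - b) = weight a - weight b := by
  simp [weight, mul_sub, Finset.sum_sub_distrib]

lemma weight_single {n : ℕ} (i : Fin n) : weight (Pi.single i 1) = (i : ℤ) + 1 := by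
  simp [weight, Pi.single_apply]

lemma weight_neg_single {n : ℕ} (i : Fin n) : weight (-Pi.single i 1) = -((i : ℤ) + 1) := by
  simp [weight, Pi.single_apply]

lemma weight_zero {n : ℕ} : weight (0 : Fin n → ℤ) = 0 := by
  simp [weight]

/-- With the next two lemmas: `weight` maps the steps bijectively onto [-n, n], a complete residue
system modulo 2n + 1. -/
lemma exists_isStep_weight {n : ℕ} {w : ℤ} (h : |w| ≤ n) :
    ∃ q : Fin n → ℤ, IsStep q ∧ weight q = w := by
  have h' := abs_le.1 h
  rcases lt_trichotomy w 0 with hw | rfl | hw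
  · refine ⟨-Pi.single ⟨(-w - 1).toNat, by omega⟩ 1, Or.inr ⟨_, Or.inr rfl⟩, ?_⟩
    rw [weight_neg_single]
    simp only
    omega
  · exact ⟨0, Or.inl rfl, weight_zero⟩
  · refine ⟨Pi.single ⟨(w - 1).toNat, by omega⟩ 1, Or.inr ⟨_, Or.inl rfl⟩, ?_⟩
    rw [weight_single]
    simp only
    omega

lemma IsStep.abs_weight_le {n : ℕ} {q : Fin n → ℤ} (hq : IsStep q) : |weight q| ≤ n := by
  rw [_root_.abs_le]
  rcases hq with rfl | ⟨i, rfl | rfl⟩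
  · rw [weight_zero]
    omega
  · rw [weight_single]
    omega
  · rw [weight_neg_single]
    omega

lemma IsStep.eq_of_weight_eq {n : ℕ} {q q' : Fin n → ℤ} (hq : IsStep q) (hq' : IsStep q')
    (h : weight q = weight q') : q = q' := by
  rcases hq with rfl | ⟨i, rfl | rfl⟩ <;> rcases hq' with rfl | ⟨k, rfl | rfl⟩ <;>
    simp only [weight_zero, weight_single, weight_neg_single] at h <;>
    first
    | rfl
    | (exfalso; omega)
    | (obtain rfl : i = k := Fin.ext (by omega)
       rfl)

/-- The standard lattice tiling. -/
lemma isIntTiling_weight (n : ℕ) :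
    IsIntTiling {l : Fin n → ℤ | (2 * (n : ℤ) + 1) ∣ weight l} := by
  intro z
  have hpos : 0 < 2 * (n : ℤ) + 1 := by omega
  have hr0 := Int.emod_nonneg (weight z + n) hpos.ne'
  have hr1 := Int.emod_lt_of_pos (weight z + n) hpos
  have hd : 2 * (n : ℤ) + 1 ∣ weight z + n - (weight z + n) % (2 * (n : ℤ) + 1) :=
    Int.dvd_self_sub_emod
  obtain ⟨q, hq, hw⟩ := exists_isStep_weight (n := n)
    (w := (weight z + n) % (2 * (n : ℤ) + 1) - n) (abs_le.2 ⟨by omega, by omega⟩)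
  refine ⟨z - q, ⟨?_, by simpa using hq⟩, ?_⟩
  · change _ ∣ weight (z - q)
    rwa [weight_sub, hw, sub_sub_eq_add_sub]
  · rintro l ⟨hl, hs⟩
    have hl' : 2 * (n : ℤ) + 1 ∣ weight l := hl
    have h1 := abs_le.1 hs.abs_weight_le
    have h2 := abs_le.1 hq.abs_weight_le
    have hdvd : 2 * (n : ℤ) + 1 ∣ weight (z - l) - weight q := by
      rw [weight_sub, hw, sub_sub_eq_add_sub, sub_add_eq_add_sub, sub_right_comm]
      exact dvd_sub hd hl'
    have h0 : weight (z - l) - weight q = 0 :=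
      Int.eq_zero_of_abs_lt_dvd hdvd (abs_lt.2 ⟨by omega, by omega⟩)
    rw [← hs.eq_of_weight_eq hq (by omega)]
    abel

/-- If an integer tiling is closed under `a - b + c`, it contains the integral midpoints of its
elements. -/
lemma IsIntTiling.midpoint_mem {n : ℕ} {Λ : Set (Fin n → ℤ)} (h : IsIntTiling Λ)
    (hΛ : ∀ a ∈ Λ, ∀ b ∈ Λ, ∀ c ∈ Λ, a - b + c ∈ Λ) {w v : Fin n → ℤ} (hw : w ∈ Λ)
    (hv : w + v + v ∈ Λ) : w + v ∈ Λ := by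
  obtain ⟨l, ⟨hl, hs⟩, hu⟩ := h (w + v)
  -- The reflection of `l` in `w + v` also covers `w + v`, as steps are symmetric; hence it equals
  -- `l`.
  have e := hu (w + v + v - l + w) ⟨hΛ _ hv _ hl _ hw, by
    convert hs.neg using 1
    abel⟩
  have : w + v = l := by
    funext j
    have := congrFun e j
    simp only [Pi.add_apply, Pi.sub_apply] at this ⊢
    omega
  rwa [this]

lemma IsIntTiling.add_single_notMem {n : ℕ} {Λ : Set (Fin n → ℤ)} (h : IsIntTiling Λ)
    (i : Fin n) {w : Fin n → ℤ} (hw : w ∈ Λ) : w + Pi.single i 1 ∉ Λ := by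
  intro hw'
  have e := (h (w + Pi.single i 1)).unique ⟨hw, Or.inr ⟨i, Or.inl (by abel)⟩⟩
    ⟨hw', Or.inl (sub_self _)⟩
  simpa using congrFun e i

/-- The tiling `Λ` cannot be turned into the tiling `Λ'` by moving some, but not all, of its
elements by `eᵢ`, if both are closed under `a - b + c`. -/
lemma false_of_partial_shift {n : ℕ} {Λ Λ' : Set (Fin n → ℤ)} (h' : IsIntTiling Λ')
    (hΛ : ∀ a ∈ Λ, ∀ b ∈ Λ, ∀ c ∈ Λ, a - b + c ∈ Λ)
    (hΛ' : ∀ a ∈ Λ', ∀ b ∈ Λ', ∀ c ∈ Λ', a - b + c ∈ Λ') (i : Fin n)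
    (hor : ∀ w ∈ Λ, w ∈ Λ' ∨ w + Pi.single i 1 ∈ Λ') {a b : Fin n → ℤ} (ha : a ∈ Λ)
    (ha' : a ∈ Λ') (hb : b ∈ Λ) (hb' : b + Pi.single i 1 ∈ Λ') : False := by
  refine h'.add_single_notMem i ?_ hb'
  -- Consider 2b - a: whether or not it is moved, `b` lands in `Λ'`, beside its neighbour b + e_i.
  rcases hor _ (hΛ b hb a ha b hb) with h | h
  · have := h'.midpoint_mem hΛ' ha' (v := b - a) (by convert h using 1; abel)
    convert this using 1
    abel
  · convert hΛ' _ h _ hb' _ ha' using 1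
    abel

/-- If the `ℤ`-tiling is unique, then the centres of every `ℤ`-tiling are closed under
`a - b + c`. -/
lemma UniqueZTiling.sub_add_mem {n : ℕ} (hunique : UniqueZTiling n) {Λ : Set (Fin n → ℤ)}
    (h : IsIntTiling Λ) : ∀ a ∈ Λ, ∀ b ∈ Λ, ∀ c ∈ Λ, a - b + c ∈ Λ := by
  obtain ⟨D, -, hD⟩ := hunique
  obtain ⟨g₀, h₀⟩ := hD _ (isIntTiling_weight n).isZTiling
  obtain ⟨g, hg⟩ := hD _ h.isZTiling
  set Λ₀ := {l : Fin n → ℤ | (2 * (n : ℤ) + 1) ∣ weight l}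
  -- Isometries onto the common tiling `D` match centres with centres by `map_center`. Being affine,
  -- they carry closure under a - b + c from the subgroup `Λ₀` to `Λ`.
  have transfer : ∀ {A B : Set (Fin n → ℤ)} (f f' : Space n ≃ᵃⁱ[ℝ] Space n),
      (fun K : Set (Space n) => f '' K) '' crosses (realVec '' A) = D →
      (fun K : Set (Space n) => f' '' K) '' crosses (realVec '' B) = D →
      ∀ a ∈ A, ∃ b ∈ B, f (WithLp.toLp 2 (realVec a)) = f' (WithLp.toLp 2 (realVec b)) := by
    intro A B f f' hf hf' a ha
    have hm : f '' cross (WithLp.toLp 2 (realVec a)) ∈ D :=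
      hf ▸ ⟨_, ⟨_, ⟨a, ha, rfl⟩, rfl⟩, rfl⟩
    rw [← hf'] at hm
    obtain ⟨_, ⟨_, ⟨b, hb, rfl⟩, rfl⟩, hK⟩ := hm
    refine ⟨b, hb, ?_⟩
    have := map_center (f.trans f'.symm) (c := WithLp.toLp 2 (realVec a))
      (d := WithLp.toLp 2 (realVec b)) (by
        dsimp only at hK
        have e : (fun x => (f.trans f'.symm) x) = f'.symm ∘ f := rfl
        rw [e, Set.image_comp, ← hK, ← Set.image_comp]
        simp)
    rw [← this]
    simp
  intro a ha b hb c hc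
  obtain ⟨a', ha', ea⟩ := transfer g g₀ hg h₀ a ha
  obtain ⟨b', hb', eb⟩ := transfer g g₀ hg h₀ b hb
  obtain ⟨c', hc', ec⟩ := transfer g g₀ hg h₀ c hc
  have hd' : a' - b' + c' ∈ Λ₀ := by
    have e : weight (a' - b' + c') = weight a' - weight b' + weight c' := by
      simp [weight, mul_sub, mul_add, Finset.sum_sub_distrib, Finset.sum_add_distrib]
    change _ ∣ weight _
    rw [e]
    exact dvd_add (dvd_sub ha' hb') hc'
  obtain ⟨d, hd, ed⟩ := transfer g₀ g h₀ hg _ hd'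
  have real : ∀ x y z : Fin n → ℤ, (WithLp.toLp 2 (realVec (x - y + z)) : Space n) =
      (WithLp.toLp 2 (realVec x) -ᵥ WithLp.toLp 2 (realVec y) : Space n) +ᵥ
        (WithLp.toLp 2 (realVec z) : Space n) := by
    intro x y z
    ext j
    simp [realVec]
  rw [real, AffineIsometryEquiv.map_vadd, AffineIsometryEquiv.map_vsub, ← ea, ← eb,
    ← ec, ← AffineIsometryEquiv.map_vsub, ← AffineIsometryEquiv.map_vadd,
    ← real] at ed
  rwa [realVec_injective (WithLp.toLp_injective 2 (g.injective ed))]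

/-! ### Regularity -/

/-- A tiling whose centres agree modulo `1` is regular. -/
lemma IsTiling.isRegular {n : ℕ} {L : Set (Set (Space n))} (hL : IsTiling L)
    (h : ∀ a ∈ centers L, ∀ b ∈ centers L, ∀ i, ∃ m : ℤ, b i = a i + m) : IsRegular L := by
  obtain ⟨a, ⟨ha, -⟩, -⟩ := hL.isHalfOpenTiling 0
  refine ⟨crosses ((fun c => c - a) '' centers L),
    ⟨(hL.isHalfOpenTiling.translate a).isTiling, ?_⟩,
    AffineIsometryEquiv.constVAdd ℝ (Space n) (-WithLp.toLp 2 a), ?_⟩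
  · rintro c ⟨_, ⟨b, hb, rfl⟩, hc⟩ i
    rw [← cross_injective hc]
    obtain ⟨m, hm⟩ := h a ha b hb i
    exact ⟨m, by simp [hm]⟩
  · have himage : ∀ c : Fin n → ℝ,
        AffineIsometryEquiv.constVAdd ℝ (Space n) (-WithLp.toLp 2 a) '' cross (WithLp.toLp 2 c) =
          cross (WithLp.toLp 2 (c - a)) := by
      intro c
      ext x
      simp only [Set.mem_image, mem_cross]
      constructor
      · rintro ⟨y, ⟨q, hq, hy⟩, rfl⟩
        refine ⟨q, hq, fun j => ?_⟩
        convert hy j using 2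
        simp
        ring
      · rintro ⟨q, hq, hy⟩
        refine ⟨WithLp.toLp 2 a + x, ⟨q, hq, fun j => ?_⟩, by simp⟩
        convert hy j using 2
        simp
        ring
    conv_lhs => rw [← crosses_centers hL]
    simp only [crosses, Set.image_image, himage]

/-- If the centres do not agree modulo `1`, moving a residue class of some coordinate yields a
partial shift of an integer tiling. -/
lemma IsHalfOpenTiling.exists_int_of_unique {n : ℕ} (hunique : UniqueZTiling n)
    {C : Set (Fin n → ℝ)} (hC : IsHalfOpenTiling C) {a b : Fin n → ℝ} (ha : a ∈ C) (hb : b ∈ C)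
    (i : Fin n) : ∃ m : ℤ, b i = a i + m := by
  classical
  by_contra hab
  -- The shift depends only on the class modulo 1, fixing that of `a i` and moving that of `b i`.
  let s : Fin n → ℝ → ℤ := fun j t => if j = i ∧ ¬ ∃ m : ℤ, t = a i + m then 1 else 0
  have hs : ∀ j (t : ℝ) (m : ℤ), s j (t + m) = s j t := by
    intro j t m
    have : (∃ k : ℤ, t + m = a i + k) ↔ ∃ k : ℤ, t = a i + k :=
      ⟨fun ⟨k, hk⟩ => ⟨k - m, by push_cast; linarith⟩, fun ⟨k, hk⟩ => ⟨k + m, by push_cast; linarith⟩⟩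
    simp only [s, this]
  let u : (Fin n → ℝ) → Fin n → ℤ := fun c j => ⌊c j⌋
  let v : (Fin n → ℝ) → Fin n → ℤ := fun c j => ⌊c j⌋ + s j (c j)
  have hu : IsIntTiling (u '' C) := by
    rw [← isHalfOpenTiling_realVec, Set.image_image]
    exact hC.image_pi (fun _ t => (⌊t⌋ : ℝ)) fun _ t m => by simp
  have hv : IsIntTiling (v '' C) := by
    rw [← isHalfOpenTiling_realVec, Set.image_image]
    have := hC.image_pi (fun j t => ((⌊t⌋ + s j t : ℤ) : ℝ)) fun j t m => by
      rw [hs]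
      push_cast [Int.floor_add_intCast]
      ring
    exact this
  have hv₀ : ∀ c, (∃ m : ℤ, c i = a i + m) → v c = u c := by
    intro c hc
    funext j
    by_cases hj : j = i
    · subst hj
      simp only [v, u, s, hc, not_true_eq_false, and_false, if_false, add_zero]
    · simp [v, u, s, hj]
  have hv₁ : ∀ c, (¬ ∃ m : ℤ, c i = a i + m) → v c = u c + Pi.single i 1 := by
    intro c hc
    funext j
    by_cases hj : j = i
    · subst hj
      simp only [v, u, s, hc, not_false_eq_true, and_self, if_true, Pi.add_apply, Pi.single_eq_same]
    · simp [v, u, s, hj]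
  refine false_of_partial_shift hv (hunique.sub_add_mem hu) (hunique.sub_add_mem hv) i ?_
    ⟨a, ha, rfl⟩ ⟨a, ha, hv₀ a ⟨0, by simp⟩⟩ ⟨b, hb, rfl⟩ ⟨b, hb, hv₁ b hab⟩
  rintro _ ⟨c, hc, rfl⟩
  by_cases h : ∃ m : ℤ, c i = a i + m
  · exact Or.inl ⟨c, hc, hv₀ c h⟩
  · exact Or.inr ⟨c, hc, hv₁ c h⟩

end CrossTiling

theorem mainTheorem2 (n : ℕ) (hp : Nat.Prime (2 * n + 1))
    (hunique : CrossTiling.UniqueZTiling n) :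
    ¬ ∃ L : Set (Set (CrossTiling.Space n)),
      CrossTiling.IsTiling L ∧ ¬ CrossTiling.IsRegular L := by
  rintro ⟨L, hL, hreg⟩
  exact hreg (hL.isRegular fun a ha b hb i =>
    hL.isHalfOpenTiling.exists_int_of_unique hunique ha hb i)
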